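/- Let $k$ be a field, let $d \ge 1$ be an integer and let $G$ be a tree with vertex set $[n]=\{1,\dots,n\}$ whose maximal vertex degree satisfies $\Delta(G)>d$. Let $L_G(d)$ be the Lovász–Saks–Schrijver ideal of $G$, that is, the ideal of the polynomial ring $k[x_{i\ell} \mid i\in[n],\ \ell\in[d]]$ generated by the polynomials $\sum_{\ell=1}^{d} x_{i\ell}x_{j\ell}$ for all edges $\{i,j\}$ of $G$. Call an ideal $I$ of a Noetherian ring a complete intersection if the minimal number of generators of $I$ equals its height, and an almost complete intersection if the minimal number of generators of $I$ equals its height plus one and, for every minimal prime $\mathfrak p$ of $I$, the localization $I_{\mathfrak p}$ is a complete intersection. Then $L_G(d)$ is an almost complete intersection if and only if $G$ is obtained from two vertex-disjoint trees $H_1$ and $H_2$ with $V(H_1)\cup V(H_2)=V(G)$ and $\Delta(H_1)\le d$, $\Delta(H_2)\le d$ by adding one edge between a vertex of $H_1$ and a vertex of $H_2$. -/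

import Mathlib

noncomputable section

/-- The quadric `f_{ij} = ∑ l, x_{il} x_{jl}` in the polynomial ring `k[x_{il} | i ∈ V, l ∈ [d]]`. -/
def lssPoly (k : Type*) [Field k] {V : Type*} (d : ℕ) (i j : V) :
    MvPolynomial (V × Fin d) k :=
  ∑ l : Fin d, MvPolynomial.X (i, l) * MvPolynomial.X (j, l)

/-- The Lovász–Saks–Schrijver ideal `L_G(d)` over `k`, generated by the `f_e`, `e` an edge
of `G`. -/
def lssIdeal (k : Type*) [Field k] {V : Type*} (G : SimpleGraph V) (d : ℕ) :
    Ideal (MvPolynomial (V × Fin d) k) :=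
  Ideal.span {f | ∃ i j : V, G.Adj i j ∧ f = lssPoly k d i j}

/-- A (finitely generated) ideal is a complete intersection if its minimal number of generators
equals its height. -/
def IsCompleteIntersectionIdeal {R : Type*} [CommRing R] (I : Ideal R) : Prop :=
  I.FG ∧ (Submodule.spanFinrank I : ℕ∞) = I.height

/-- A (finitely generated) ideal is an almost complete intersection if its minimal number of
generators is one more than its height, and its localization at each of its minimal primes is a
complete intersection. -/
def IsAlmostCompleteIntersectionIdeal {R : Type*} [CommRing R] (I : Ideal R) : Prop :=
  I.FG ∧ (Submodule.spanFinrank I : ℕ∞) = I.height + 1 ∧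
    ∀ (p : Ideal R) [p.IsPrime], p ∈ I.minimalPrimes →
      IsCompleteIntersectionIdeal (I.map (algebraMap R (Localization.AtPrime p)))

open Classical in
/-- `G` is obtained from two vertex-disjoint trees `H₁`, `H₂`, which together cover the vertices
of `G` and have maximal degree at most `d`, by adding an edge `uv` between a vertex `u` of `H₁`
and a vertex `v` of `H₂`. -/
def IsEdgeJoinOfTrees {V : Type*} [Fintype V] (G : SimpleGraph V) (d : ℕ) : Prop :=
  ∃ H₁ H₂ : G.Subgraph,
    H₁.coe.IsTree ∧ H₂.coe.IsTree ∧
    Disjoint H₁.verts H₂.verts ∧ H₁.verts ∪ H₂.verts = Set.univ ∧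
    H₁.coe.maxDegree ≤ d ∧ H₂.coe.maxDegree ≤ d ∧
    ∃ u ∈ H₁.verts, ∃ v ∈ H₂.verts,
      G = H₁.spanningCoe ⊔ H₂.spanningCoe ⊔ SimpleGraph.edge u v

end

/-! ### Ideals whose generators have pairwise coprime leading monomials. -/

noncomputable section CoprimeLeadingMonomials

open MvPolynomial
open scoped MonomialOrder

namespace MonomialOrder

variable {σ ι k : Type*} [Field k] {m : MonomialOrder σ} {f : ι → MvPolynomial σ k}

/-! Everything reduces to comparing the height of `L_G(d)` with the number of edges, which is its
minimal number of generators (`spanFinrank_lssIdeal`).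

Upper bounds on the height come from setting all variables of a vertex set `Z` to zero, which costs
`d * |Z|` equations and disposes of every edge meeting `Z` (`height_lssIdeal_le`). Lower bounds come
from forests `F` of maximal degree at most `d`: a proper edge colouring with `d` colours yields a
monomial order with squarefree, pairwise coprime leading monomials (`exists_monomialOrder`), so
`L_F(d)` is radical of height at least the number of edges of `F`.

If `G` is an edge join, let `F` be the union of the two trees. Then `L_F(d)` and a vertex of degree
above `d` pin the height to `|E| - 1`. A minimal prime of height at least `|E|` causes no trouble;
any other is minimal over the radical ideal `L_F(d)`, so the extra generator becomes redundant after
localizing.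

Conversely, height `|E| - 1` forces all degrees to be at most `d + 1` and any two vertices of degree
above `d` to be adjacent. A tree has no triangle, so there are at most two such vertices, and
deleting one suitable edge lowers every degree to at most `d`. -/

/-- Every polynomial can be reduced, modulo a family of nonzero polynomials, to one none of whose
monomials is divisible by a leading monomial of the family. -/
theorem exists_reduced (hf : ∀ i, f i ≠ 0) (S : Set ι) (g : MvPolynomial σ k) :
    ∃ r, g - r ∈ Ideal.span (f '' S) ∧
      ∀ c ∈ r.support, ∀ i ∈ S, ¬ m.degree (f i) ≤ c := by
  obtain ⟨q, r, hg, -, hr⟩ := m.div (b := fun i : S ↦ f i)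
    (fun i ↦ isUnit_iff_ne_zero.2 (m.leadingCoeff_ne_zero_iff.2 (hf i))) g
  refine ⟨r, ?_, fun c hc i hi ↦ hr c hc ⟨i, hi⟩⟩
  rw [hg, add_sub_cancel_right, Finsupp.linearCombination_apply]
  exact Ideal.sum_mem _ fun i _ ↦ Ideal.mul_mem_left _ _
    (Ideal.subset_span ⟨i, i.2, rfl⟩)

/-- If the leading monomials of a finite family are pairwise coprime, then every nonzero element of
the ideal it generates has a leading monomial divisible by that of a member of the family. -/
theorem exists_degree_le_of_mem_span (hf : ∀ i, f i ≠ 0)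
    (hd : Pairwise fun i j ↦ ∀ s, m.degree (f i) s = 0 ∨ m.degree (f j) s = 0)
    (S : Finset ι) {g : MvPolynomial σ k} (hg : g ∈ Ideal.span (f '' S)) (h0 : g ≠ 0) :
    ∃ i ∈ S, m.degree (f i) ≤ m.degree g := by
  classical
  induction S using Finset.induction_on generalizing g with
  | empty => simp at hg; exact absurd hg h0
  | insert a S ha ih =>
    rw [Finset.coe_insert, Set.image_insert_eq, Ideal.mem_span_insert] at hg
    obtain ⟨q, z, hz, rfl⟩ := hg
    -- Replacing `q` by its remainder `r` modulo `S` moves the difference into the second summand;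
    -- it makes cancellation of leading terms impossible.
    obtain ⟨r, hr, hr'⟩ := exists_reduced (m := m) hf (S : Set ι) q
    have hz' : (q - r) * f a + z ∈ Ideal.span (f '' (S : Set ι)) :=
      Ideal.add_mem _ (Ideal.mul_mem_right _ _ hr) hz
    have hgz : q * f a + z = r * f a + ((q - r) * f a + z) := by ring
    rw [hgz] at h0 ⊢
    generalize (q - r) * f a + z = z' at *
    by_cases hr0 : r = 0
    · simp only [hr0, zero_mul, zero_add] at h0 ⊢
      obtain ⟨i, hi, h⟩ := ih hz' h0
      exact ⟨i, Finset.mem_insert_of_mem hi, h⟩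
    have hdeg : m.degree (r * f a) = m.degree r + m.degree (f a) := m.degree_mul hr0 (hf a)
    by_cases hz0 : z' = 0
    · refine ⟨a, Finset.mem_insert_self _ _, ?_⟩
      rw [hz0, add_zero, hdeg]
      exact le_add_self
    obtain ⟨i, hi, h⟩ := ih hz' hz0
    -- Otherwise the leading monomial of `f i` divides that of `r * f a`; being coprime to that of
    -- `f a`, it divides that of the reduced `r`.
    have hne : m.degree (r * f a) ≠ m.degree z' := by
      intro he
      refine hr' _ (m.degree_mem_support hr0) i hi fun s ↦ ?_
      have h1 := h s
      rw [← he, hdeg, Finsupp.add_apply] at h1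
      rcases hd (show i ≠ a from fun e ↦ ha (e ▸ hi)) s with h2 | h2 <;> omega
    rcases lt_or_gt_of_ne (fun e ↦ hne (m.toSyn.injective e)) with hlt | hlt
    · rw [m.degree_add_eq_right_of_lt hlt]
      exact ⟨i, Finset.mem_insert_of_mem hi, h⟩
    · rw [m.degree_add_of_lt hlt, hdeg]
      exact ⟨a, Finset.mem_insert_self _ _, le_add_self⟩

/-- If the leading monomials are pairwise coprime, a member of the family is a nonzerodivisor
modulo finitely many others. -/
theorem mem_span_of_mul_mem_span (hf : ∀ i, f i ≠ 0)
    (hd : Pairwise fun i j ↦ ∀ s, m.degree (f i) s = 0 ∨ m.degree (f j) s = 0)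
    {S : Finset ι} {a : ι} (ha : a ∉ S) {g : MvPolynomial σ k}
    (hg : f a * g ∈ Ideal.span (f '' S)) : g ∈ Ideal.span (f '' S) := by
  obtain ⟨r, hr, hr'⟩ := exists_reduced (m := m) hf (S : Set ι) g
  by_cases hr0 : r = 0
  · simpa [hr0] using hr
  have h1 : f a * r ∈ Ideal.span (f '' (S : Set ι)) := by
    have := Ideal.sub_mem _ hg (Ideal.mul_mem_left _ (f a) hr)
    rwa [← mul_sub, sub_sub_cancel] at this
  obtain ⟨i, hi, h⟩ := exists_degree_le_of_mem_span hf hd S h1 (mul_ne_zero (hf a) hr0)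
  rw [m.degree_mul (hf a) hr0] at h
  refine absurd (fun s ↦ ?_) (hr' _ (m.degree_mem_support hr0) i hi)
  have h1 := h s
  rw [Finsupp.add_apply] at h1
  rcases hd (show i ≠ a from fun e ↦ ha (e ▸ hi)) s with h2 | h2 <;> omega

/-- An ideal generated by polynomials with pairwise coprime squarefree leading monomials is
radical. -/
theorem isRadical_span (hf : ∀ i, f i ≠ 0)
    (hd : Pairwise fun i j ↦ ∀ s, m.degree (f i) s = 0 ∨ m.degree (f j) s = 0)
    (hsq : ∀ i s, m.degree (f i) s ≤ 1) (S : Finset ι) :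
    (Ideal.span (f '' S)).IsRadical := by
  intro g hg
  obtain ⟨N, hN⟩ := hg
  obtain ⟨r, hr, hr'⟩ := exists_reduced (m := m) hf (S : Set ι) g
  by_cases hr0 : r = 0
  · simpa [hr0] using hr
  have h1 : r ^ N ∈ Ideal.span (f '' (S : Set ι)) := by
    have := Ideal.sub_mem _ hN (Ideal.mem_of_dvd _ (sub_dvd_pow_sub_pow g r N) hr)
    rwa [sub_sub_cancel] at this
  obtain ⟨i, hi, h⟩ := exists_degree_le_of_mem_span hf hd S h1 (pow_ne_zero N hr0)
  -- A squarefree monomial dividing a power of a monomial divides the monomial itself.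
  refine absurd (fun s ↦ ?_) (hr' _ (m.degree_mem_support hr0) i hi)
  have h1 := h s
  rw [m.degree_pow, Finsupp.smul_apply, smul_eq_mul] at h1
  have h2 := hsq i s
  by_contra hlt
  have : m.degree r s = 0 := by omega
  rw [this, mul_zero] at h1
  omega

/-- An ideal generated by `r` polynomials with pairwise coprime leading monomials has height at
least `r`. -/
theorem card_le_height_span (hf : ∀ i, f i ≠ 0)
    (hd : Pairwise fun i j ↦ ∀ s, m.degree (f i) s = 0 ∨ m.degree (f j) s = 0)
    (S : Finset ι) : (S.card : ℕ∞) ≤ (Ideal.span (f '' S)).height := by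
  classical
  induction S using Finset.induction_on with
  | empty => simp
  | insert a S ha ih =>
    rw [Finset.card_insert_of_notMem ha, Ideal.height_eq_inf_minimalPrimes]
    refine le_iInf₂ fun p hp ↦ ?_
    have := hp.isPrime
    have hle := hp.le
    -- Elements of a minimal prime are zero divisors modulo the ideal, so `f a` lies in `p` but not
    -- in `q`, and the height grows by one.
    obtain ⟨q, hq, hqp⟩ := Ideal.exists_minimalPrimes_le
      ((Ideal.span_mono (Set.image_mono (Finset.coe_subset.2 (Finset.subset_insert a S)))).trans hle)
    have := hq.isPrime
    have haq : f a ∉ q := fun h ↦ by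
      obtain ⟨y, hy, hy'⟩ := Ideal.exists_mul_mem_of_mem_minimalPrimes hq h
      exact hy (mem_span_of_mul_mem_span hf hd ha hy')
    have hlt : q < p := lt_of_le_of_ne hqp fun e ↦ haq <| e ▸ hle
      (Ideal.subset_span ⟨a, by simp, rfl⟩)
    push_cast
    refine le_trans ?_ (Ideal.height_add_one_le_of_lt_of_isPrime hlt)
    gcongr
    exact ih.trans (Ideal.height_mono hq.le)

end MonomialOrder

end CoprimeLeadingMonomials

/-! ### Edge colourings of forests induced by vertex rankings. -/

noncomputable section ForestOrder

namespace SimpleGraph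

variable {V : Type*} {F : SimpleGraph V}

/-- Every nonempty finite set of vertices of a forest contains a vertex with at most one neighbour
in the set. -/
theorem IsAcyclic.exists_subsingleton_neighbor (hF : F.IsAcyclic) {S : Finset V}
    (hS : S.Nonempty) :
    ∃ v ∈ S, ∀ u ∈ S, ∀ w ∈ S, F.Adj v u → F.Adj v w → u = w := by
  classical
  have hne : Nonempty S := hS.to_subtype
  -- The induced forest extends to a tree `T` on `S`; a leaf of `T` has at most one neighbour in the
  -- forest.
  obtain ⟨T, hFT, -, hT⟩ := (connected_top (V := S)).exists_isTree_le_of_le_of_isAcyclic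
    (H := F.induce (S : Set V)) le_top (hF.comap (Embedding.induce (S : Set V)).toHom
      Subtype.val_injective)
  rcases subsingleton_or_nontrivial S with h | h
  · obtain ⟨v, hv⟩ := hS
    refine ⟨v, hv, fun u hu w hw _ _ ↦ ?_⟩
    exact congrArg Subtype.val (Subsingleton.elim (⟨u, hu⟩ : S) ⟨w, hw⟩)
  · obtain ⟨v, hv⟩ := hT.exists_vert_degree_one_of_nontrivial
    obtain ⟨x, -, hx⟩ := degree_eq_one_iff_existsUnique_adj.1 hv
    refine ⟨v, v.2, fun u hu w hw h1 h2 ↦ ?_⟩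
    have hu' := hx ⟨u, hu⟩ (hFT (by simpa using h1))
    have hw' := hx ⟨w, hw⟩ (hFT (by simpa using h2))
    exact congrArg Subtype.val (hu'.trans hw'.symm)

/-- A forest of maximal degree at most `d` has an injective ranking `r` of the vertices and a vertex
labelling `c` by `d` colours such that labelling each edge by the colour of its endpoint of lower
rank is a proper edge colouring. -/
theorem IsAcyclic.exists_ranking_coloring [Finite V] (hF : F.IsAcyclic) {d : ℕ} (hd : 0 < d)
    (hdeg : ∀ v, (F.neighborSet v).ncard ≤ d) :
    ∃ (r : V → ℤ) (c : V → Fin d), r.Injective ∧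
      ∀ v u w, F.Adj v u → F.Adj v w → u ≠ w →
        (if r v < r u then c v else c u) ≠ (if r v < r w then c v else c w) := by
  classical
  have := Fintype.ofFinite V
  suffices h : ∀ S : Finset V, ∃ (r : V → ℤ) (c : V → Fin d), Set.InjOn r S ∧
      ∀ v ∈ S, ∀ u ∈ S, ∀ w ∈ S, F.Adj v u → F.Adj v w → u ≠ w →
        (if r v < r u then c v else c u) ≠ (if r v < r w then c v else c w) by
    obtain ⟨r, c, hr, hc⟩ := h Finset.univ
    exact ⟨r, c, fun x y h ↦ hr (by simp) (by simp) h,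
      fun v u w ↦ hc v (by simp) u (by simp) w (by simp)⟩
  intro S
  induction S using Finset.strongInduction with
  | H S ih =>
    rcases S.eq_empty_or_nonempty with rfl | hS
    · exact ⟨fun _ ↦ 0, fun _ ↦ ⟨0, hd⟩, by simp, by simp⟩
    obtain ⟨v, hv, hleaf⟩ := hF.exists_subsingleton_neighbor hS
    obtain ⟨r, c, hr, hc⟩ := ih _ (Finset.erase_ssubset hv)
    obtain ⟨b, hb⟩ := (S.image r).bddBelow
    have hb' : ∀ u ∈ S, b - 1 < r u := fun u hu ↦ by
      have := hb (Finset.mem_coe.2 (Finset.mem_image_of_mem r hu)); omega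
    -- The leaf `v` will get the lowest rank `b - 1`, so its edge to `p` takes the colour of `v`. At
    -- most `d - 1` colours are already used at `p`, leaving one free.
    obtain ⟨a, ha⟩ : ∃ a : Fin d, ∀ p ∈ S, F.Adj v p → ∀ w ∈ S, w ≠ v → F.Adj p w →
        a ≠ (if r p < r w then c p else c w) := by
      by_cases hp : ∃ p ∈ S, F.Adj v p
      · obtain ⟨p, hpS, hp⟩ := hp
        let A : Finset (Fin d) := ((F.neighborFinset p).erase v).image
          fun w ↦ if r p < r w then c p else c w
        have hA : A.card < Fintype.card (Fin d) := by
          refine Finset.card_image_le.trans_lt ?_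
          rw [Finset.card_erase_of_mem (by simpa using hp.symm), Fintype.card_fin]
          have h1 := hdeg p
          rw [← coe_neighborFinset, Set.ncard_coe_finset] at h1
          omega
        obtain ⟨a, ha⟩ : ∃ a, a ∉ A := by
          by_contra! h
          exact hA.ne (by rw [Finset.eq_univ_iff_forall.2 h, Finset.card_univ])
        refine ⟨a, fun p' hp' hvp' w hw hwv hpw e ↦ ha ?_⟩
        obtain rfl := hleaf p hpS p' hp' hp hvp'
        exact Finset.mem_image.2 ⟨w, by simp [hwv, hpw], e.symm⟩
      · push Not at hp
        exact ⟨⟨0, hd⟩, fun p hp1 hp2 ↦ absurd hp2 (hp p hp1)⟩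
    refine ⟨Function.update r v (b - 1), Function.update c v a, ?_, ?_⟩
    · intro x hx y hy hxy
      rcases eq_or_ne x v with rfl | hxv <;> rcases eq_or_ne y x with rfl | hyx
      · rfl
      · rw [Function.update_self, Function.update_of_ne hyx] at hxy
        exact absurd hxy (hb' y hy).ne
      · rfl
      · rw [Function.update_of_ne hxv] at hxy
        rcases eq_or_ne y v with rfl | hyv
        · rw [Function.update_self] at hxy
          exact absurd hxy (hb' x hx).ne'
        · rw [Function.update_of_ne hyv] at hxy
          exact hr (by simpa [hxv] using hx) (by simpa [hyv] using hy) hxy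
    · intro z hz u hu w hw hzu hzw huw
      rcases eq_or_ne z v with rfl | hzv
      · exact absurd (hleaf u hu w hw hzu hzw) huw
      have hnlt : ¬ r z < b - 1 := not_lt.2 (hb' z hz).le
      rcases eq_or_ne u v with rfl | huv
      · simp only [Function.update_self, Function.update_of_ne hzv, Function.update_of_ne huw.symm,
          if_neg hnlt]
        exact ha z hz hzu.symm w hw huw.symm hzw
      rcases eq_or_ne w v with rfl | hwv
      · simp only [Function.update_self, Function.update_of_ne hzv, Function.update_of_ne huv,
          if_neg hnlt]
        exact (ha z hz hzw.symm u hu huv hzu).symm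
      simp only [Function.update_of_ne hzv, Function.update_of_ne huv, Function.update_of_ne hwv]
      exact hc z (by simp [hzv, hz]) u (by simp [huv, hu]) w (by simp [hwv, hw]) hzu hzw huw

end SimpleGraph

end ForestOrder

/-! ### Leading monomials of the edge quadrics. -/

noncomputable section EdgePoly

open MvPolynomial
open scoped MonomialOrder

universe u

variable (k : Type*) [Field k] {V : Type u} (d : ℕ)

theorem lssPoly_comm (i j : V) : lssPoly k d i j = lssPoly k d j i := by
  simp only [lssPoly, mul_comm]

/-- The quadric attached to an unordered pair of vertices. -/
def edgePoly (e : Sym2 V) : MvPolynomial (V × Fin d) k :=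
  Sym2.lift ⟨lssPoly k d, lssPoly_comm k d⟩ e

@[simp]
theorem edgePoly_mk (i j : V) : edgePoly k d s(i, j) = lssPoly k d i j := rfl

theorem lssIdeal_eq_span (G : SimpleGraph V) :
    lssIdeal k G d = Ideal.span (edgePoly k d '' G.edgeSet) := by
  unfold lssIdeal
  congr 1
  ext f
  constructor
  · rintro ⟨i, j, h, rfl⟩
    exact ⟨s(i, j), h, rfl⟩
  · rintro ⟨e, he, rfl⟩
    induction e with
    | h i j => exact ⟨i, j, he, rfl⟩

theorem coeff_lssPoly [DecidableEq V] (i j : V) (e : V × Fin d →₀ ℕ) :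
    (lssPoly k d i j).coeff e =
      ∑ l, if Finsupp.single (i, l) 1 + Finsupp.single (j, l) 1 = e then 1 else 0 := by
  rw [lssPoly, coeff_sum]
  refine Finset.sum_congr rfl fun l _ ↦ ?_
  rw [X, X, monomial_mul, one_mul, coeff_monomial]

theorem single_add_single_injective (i j : V) :
    Function.Injective fun l : Fin d ↦
      (Finsupp.single (i, l) 1 + Finsupp.single (j, l) 1 : V × Fin d →₀ ℕ) := by
  classical
  intro l l' h
  by_contra hne
  have := DFunLike.congr_fun h (i, l)
  simp [Finsupp.single_apply, Ne.symm hne] at this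

variable {k d}

/-- Distinct `l` give distinct monomials, so every occurring coefficient is `1` and nothing cancels
in any characteristic, even when `i = j`. -/
theorem coeff_lssPoly_ne_zero {i j : V} {e : V × Fin d →₀ ℕ} :
    (lssPoly k d i j).coeff e ≠ 0 ↔
      ∃ l, Finsupp.single (i, l) 1 + Finsupp.single (j, l) 1 = e := by
  classical
  rw [coeff_lssPoly]
  constructor
  · intro h
    obtain ⟨l, -, hl⟩ := Finset.exists_ne_zero_of_sum_ne_zero h
    exact ⟨l, by by_contra h'; simp [h'] at hl⟩
  · rintro ⟨l, rfl⟩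
    rw [Finset.sum_eq_single l]
    · simp
    · intro l' _ hl
      rw [if_neg fun h ↦ hl (single_add_single_injective d i j h)]
    · simp

theorem lssPoly_ne_zero (hd : 0 < d) (i j : V) : lssPoly k d i j ≠ 0 := fun h ↦
  (coeff_lssPoly_ne_zero (k := k) (i := i) (j := j)).2 ⟨(⟨0, hd⟩ : Fin d), rfl⟩ (by simp [h])

/-- The leading monomial of `lssPoly k d i j` in a lexicographic order in which some `x_{ia}` is
larger than all the other variables with first index `i` or `j`. -/
theorem degree_lex_lssPoly [LinearOrder (V × Fin d)] [WellFoundedGT (V × Fin d)] {i j : V}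
    {a : Fin d} (hij : i ≠ j) (hi : ∀ l, (i, a) ≤ (i, l)) (hj : ∀ l, (i, a) ≤ (j, l)) :
    (MonomialOrder.lex (σ := V × Fin d)).degree (lssPoly k d i j) =
      Finsupp.single (i, a) 1 + Finsupp.single (j, a) 1 := by
  classical
  apply MonomialOrder.lex.toSyn.injective
  apply le_antisymm
  · rw [MonomialOrder.degree_le_iff]
    intro c hc
    rw [mem_support_iff, coeff_lssPoly_ne_zero] at hc
    obtain ⟨l, rfl⟩ := hc
    rcases eq_or_ne l a with rfl | hl
    · exact le_rfl
    refine le_of_lt (MonomialOrder.lex_lt_iff.2 ?_)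
    refine ⟨(i, a), fun t ht ↦ ?_, ?_⟩
    · have h1 : ∀ l, (i, l) ≠ t := fun l e ↦ ((hi l).trans_lt (e ▸ ht)).false
      have h2 : ∀ l, (j, l) ≠ t := fun l e ↦ ((hj l).trans_lt (e ▸ ht)).false
      simp [h1, h2]
    · simp [hl, hij.symm]
  · apply MonomialOrder.le_degree
    rw [mem_support_iff, coeff_lssPoly_ne_zero]
    exact ⟨a, rfl⟩

/-- For a forest of maximal degree at most `d` there is a monomial order for which the leading
monomials of the generators of its Lovász–Saks–Schrijver ideal are squarefree and pairwise
coprime. -/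
theorem SimpleGraph.IsAcyclic.exists_monomialOrder [Finite V] {F : SimpleGraph V}
    (hF : F.IsAcyclic) (hd : 0 < d) (hdeg : ∀ v, (F.neighborSet v).ncard ≤ d) :
    ∃ m : MonomialOrder.{u, u} (V × Fin d),
      (∀ (e : F.edgeSet) s, m.degree (edgePoly k d (e : Sym2 V)) s ≤ 1) ∧
      Pairwise fun e e' : F.edgeSet ↦ ∀ s, m.degree (edgePoly k d (e : Sym2 V)) s = 0 ∨
        m.degree (edgePoly k d (e' : Sym2 V)) s = 0 := by
  classical
  obtain ⟨r, c, hr, hc⟩ := hF.exists_ranking_coloring hd hdeg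
  -- Smaller indices are larger variables in `lex`. Rank comes first, then the preferred colour of
  -- each vertex; the final `p.2` only breaks ties.
  let key : V × Fin d → ℤ ×ₗ ℕ ×ₗ Fin d := fun p ↦
    toLex (r p.1, toLex (if p.2 = c p.1 then 0 else 1, p.2))
  have hkey : key.Injective := by
    rintro ⟨i, l⟩ ⟨j, l'⟩ h
    have h := toLex.injective h
    have h1 := (Prod.mk.inj h).1
    have h2 := (Prod.mk.inj (toLex.injective (Prod.mk.inj h).2)).2
    exact Prod.ext (hr h1) h2
  let _ : LinearOrder (V × Fin d) := LinearOrder.lift' key hkey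
  have hdg : ∀ i j, F.Adj i j → MonomialOrder.lex.degree (lssPoly k d i j) =
      Finsupp.single (i, if r i < r j then c i else c j) 1 +
        Finsupp.single (j, if r i < r j then c i else c j) 1 := by
    have key_i : ∀ i l, (i, c i) ≤ (i, l) := fun i l ↦ by
      change key _ ≤ key _
      simp only [key, Prod.Lex.toLex_le_toLex, lt_self_iff_false, true_and, false_or, if_true]
      split_ifs with h
      · right; simp [h]
      · left; exact Nat.zero_lt_one
    have key_j : ∀ i j l, r i < r j → (i, c i) ≤ (j, l) := fun i j l h ↦ by
      change key _ ≤ key _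
      exact Prod.Lex.toLex_le_toLex.2 (Or.inl h)
    intro i j hij
    rcases lt_or_gt_of_ne (hr.ne hij.ne) with h | h
    · rw [if_pos h]
      exact degree_lex_lssPoly hij.ne (key_i i) fun l ↦ key_j i j l h
    · rw [if_neg h.not_gt, lssPoly_comm, add_comm]
      exact degree_lex_lssPoly hij.ne' (key_i j) fun l ↦ key_j j i l h
  -- A variable `(v, l)` in a leading monomial means that the edge meets `v` and has colour `l`; a
  -- proper colouring thus gives coprimality.
  have hsupp : ∀ i j l v, F.Adj i j → MonomialOrder.lex.degree (lssPoly k d i j) (v, l) ≠ 0 →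
      ∃ u, F.Adj v u ∧ s(i, j) = s(v, u) ∧ l = if r v < r u then c v else c u := by
    intro i j l v hij h
    rw [hdg i j hij, Finsupp.add_apply, Finsupp.single_apply, Finsupp.single_apply] at h
    by_cases h1 : (i, if r i < r j then c i else c j) = (v, l)
    · obtain ⟨rfl, rfl⟩ := Prod.mk.inj h1
      exact ⟨j, hij, rfl, rfl⟩
    · by_cases h2 : (j, if r i < r j then c i else c j) = (v, l)
      · obtain ⟨rfl, rfl⟩ := Prod.mk.inj h2
        refine ⟨i, hij.symm, Sym2.eq_swap, ?_⟩
        rcases lt_or_gt_of_ne (hr.ne hij.ne) with h | h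
        · rw [if_pos h, if_neg h.not_gt]
        · rw [if_neg h.not_gt, if_pos h]
      · simp [h1, h2] at h
  refine ⟨MonomialOrder.lex, ?_, ?_⟩
  · rintro ⟨e, he⟩ s
    induction e with
    | h i j =>
      have hij : i ≠ j := he.ne
      rw [edgePoly_mk, hdg i j he, Finsupp.add_apply]
      generalize (if r i < r j then c i else c j) = a
      rw [Finsupp.single_apply, Finsupp.single_apply]
      split_ifs with h1 h2 <;> first | omega | skip
      exact (hij (Prod.mk.inj (h1.trans h2.symm)).1).elim
  · rintro ⟨e, he⟩ ⟨e', he'⟩ hne ⟨v, l⟩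
    induction e with
    | h i j =>
    induction e' with
    | h i' j' =>
      by_contra! h
      obtain ⟨u, hu, h1, hl⟩ := hsupp i j l v he h.1
      obtain ⟨w, hw, h2, hl'⟩ := hsupp i' j' l v he' h.2
      refine hc v u w hu hw (fun e ↦ hne (Subtype.ext ?_)) (hl.symm.trans hl')
      simp only [h1, h2, e]

theorem edgePoly_ne_zero (hd : 0 < d) (e : Sym2 V) : edgePoly k d e ≠ 0 := by
  induction e with
  | h i j => exact lssPoly_ne_zero hd i j

theorem lssIdeal_eq_span_univ [Finite V] (F : SimpleGraph V) [Fintype F.edgeSet] :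
    lssIdeal k F d = Ideal.span ((fun e : F.edgeSet ↦ edgePoly k d (e : Sym2 V)) ''
      ((Finset.univ : Finset F.edgeSet) : Set F.edgeSet)) := by
  rw [lssIdeal_eq_span, Finset.coe_univ, Set.image_univ, Set.image_eq_range]

/-- The Lovász–Saks–Schrijver ideal of a forest of maximal degree at most `d` is radical. -/
theorem SimpleGraph.IsAcyclic.isRadical_lssIdeal [Finite V] {F : SimpleGraph V}
    (hF : F.IsAcyclic) (hd : 0 < d) (hdeg : ∀ v, (F.neighborSet v).ncard ≤ d) :
    (lssIdeal k F d).IsRadical := by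
  classical
  have := Fintype.ofFinite V
  obtain ⟨m, h1, h2⟩ := hF.exists_monomialOrder (k := k) hd hdeg
  rw [lssIdeal_eq_span_univ]
  exact MonomialOrder.isRadical_span (fun e ↦ edgePoly_ne_zero hd _) h2 h1 _

/-- The Lovász–Saks–Schrijver ideal of a forest of maximal degree at most `d` has height at least
the number of edges. -/
theorem SimpleGraph.IsAcyclic.ncard_edgeSet_le_height_lssIdeal [Finite V] {F : SimpleGraph V}
    (hF : F.IsAcyclic) (hd : 0 < d) (hdeg : ∀ v, (F.neighborSet v).ncard ≤ d) :
    (F.edgeSet.ncard : ℕ∞) ≤ (lssIdeal k F d).height := by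
  classical
  have := Fintype.ofFinite V
  obtain ⟨m, h1, h2⟩ := hF.exists_monomialOrder (k := k) hd hdeg
  rw [lssIdeal_eq_span_univ]
  have := MonomialOrder.card_le_height_span (fun e ↦ edgePoly_ne_zero (k := k) hd _) h2 Finset.univ
  rwa [Finset.card_univ, ← Nat.card_eq_fintype_card, Nat.card_coe_set_eq] at this

end EdgePoly

/-! ### Minimal number of generators and upper bounds on the height. -/

noncomputable section NumberOfGenerators

open MvPolynomial

universe u

variable {k : Type*} [Field k] {V : Type u} {d : ℕ}

theorem coeff_edgePoly_eq_zero_of_degree_ne_two {e : Sym2 V} {c : V × Fin d →₀ ℕ}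
    (hc : c.degree ≠ 2) : (edgePoly k d e).coeff c = 0 := by
  induction e with
  | h i j =>
    by_contra h
    obtain ⟨l, rfl⟩ := coeff_lssPoly_ne_zero.1 h
    simp [map_add] at hc

theorem coeff_eq_zero_of_mem_lssIdeal {G : SimpleGraph V} {g : MvPolynomial (V × Fin d) k}
    (hg : g ∈ lssIdeal k G d) {c : V × Fin d →₀ ℕ} (hc : c.degree < 2) : g.coeff c = 0 := by
  classical
  rw [lssIdeal_eq_span] at hg
  induction hg using Submodule.span_induction generalizing c with
  | mem x h =>
    obtain ⟨e, -, rfl⟩ := h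
    exact coeff_edgePoly_eq_zero_of_degree_ne_two hc.ne
  | zero => simp
  | add x y _ _ hx hy => rw [coeff_add, hx hc, hy hc, add_zero]
  | smul a x _ hx =>
    rw [smul_eq_mul, coeff_mul]
    refine Finset.sum_eq_zero fun p hp ↦ ?_
    rw [Finset.HasAntidiagonal.mem_antidiagonal] at hp
    rw [hx (by rw [← hp, map_add] at hc; omega), mul_zero]

/-- Elements of the ideal start in degree two, so only the constant term of the multiplier
contributes. Quadratic coefficients thereby turn ideal generators into `k`-linear spanning sets. -/
theorem coeff_mul_of_mem_lssIdeal {G : SimpleGraph V} {g : MvPolynomial (V × Fin d) k}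
    (hg : g ∈ lssIdeal k G d) {c : V × Fin d →₀ ℕ} (hc : c.degree = 2)
    (a : MvPolynomial (V × Fin d) k) : (a * g).coeff c = a.coeff 0 * g.coeff c := by
  classical
  rw [coeff_mul, Finset.sum_eq_single (0, c)]
  · rintro ⟨x, y⟩ hp hne
    rw [Finset.HasAntidiagonal.mem_antidiagonal] at hp
    simp only at hp ⊢
    rw [coeff_eq_zero_of_mem_lssIdeal hg, mul_zero]
    have h1 : x.degree + y.degree = 2 := by rw [← map_add, hp, hc]
    have h2 : x.degree ≠ 0 := fun h ↦ hne (by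
      obtain rfl := (Finsupp.degree_eq_zero_iff x).1 h
      rw [← hp, zero_add])
    omega
  · simp

/-- A monomial that occurs in the quadric of exactly one edge. -/
theorem exists_coeff_edgePoly_ne_zero_iff (hd : 0 < d) (e : Sym2 V) :
    ∃ c : V × Fin d →₀ ℕ, c.degree = 2 ∧ ∀ e', (edgePoly k d e').coeff c ≠ 0 ↔ e' = e := by
  classical
  induction e with
  | h i j =>
    refine ⟨Finsupp.single (i, ⟨0, hd⟩) 1 + Finsupp.single (j, ⟨0, hd⟩) 1, by simp [map_add],
      fun e' ↦ ?_⟩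
    induction e' with
    | h i' j' =>
      rw [edgePoly_mk, coeff_lssPoly_ne_zero]
      constructor
      · rintro ⟨l, h⟩
        -- Forgetting the second index recovers the multiset of endpoints from the monomial.
        have h' := congrArg (Finsupp.mapDomain Prod.fst) h
        simp only [Finsupp.mapDomain_add, Finsupp.mapDomain_single] at h'
        have h'' := congrArg Finsupp.toMultiset h'
        simp only [map_add, Finsupp.toMultiset_single, one_smul] at h''
        refine Sym2.ext fun x ↦ ?_
        have := congrArg (x ∈ ·) h''
        simpa using this
      · intro h
        rcases Sym2.eq_iff.1 h with ⟨rfl, rfl⟩ | ⟨rfl, rfl⟩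
        · exact ⟨_, rfl⟩
        · exact ⟨_, add_comm _ _⟩

/-- The minimal number of generators of a Lovász–Saks–Schrijver ideal is the number of edges. -/
theorem spanFinrank_lssIdeal [Finite V] (hd : 0 < d) (G : SimpleGraph V) :
    (lssIdeal k G d).spanFinrank = G.edgeSet.ncard := by
  classical
  have := Fintype.ofFinite V
  apply le_antisymm
  · rw [lssIdeal_eq_span]
    exact (Submodule.spanFinrank_span_le_ncard_of_finite ((Set.toFinite _).image _)).trans
      (Set.ncard_image_le (Set.toFinite _))
  · obtain ⟨s, hs, hspan⟩ := Submodule.FG.exists_span_finset_card_eq_spanFinrank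
      (IsNoetherian.noetherian (lssIdeal k G d))
    choose c hc hc' using exists_coeff_edgePoly_ne_zero_iff (k := k) (V := V) hd
    -- One distinguishing monomial per edge: `φ` sends any generating set of the ideal to a spanning
    -- set of `k^E`.
    let φ : MvPolynomial (V × Fin d) k →ₗ[k] (G.edgeSet → k) :=
      LinearMap.pi fun e ↦ lcoeff k (c e)
    have hφ : ∀ g ∈ lssIdeal k G d, φ g ∈ Submodule.span k ((s.image φ : Finset _) : Set _) := by
      intro g hg
      rw [← hspan] at hg
      induction hg using Submodule.span_induction with
      | mem x h => exact Submodule.subset_span (by simpa using ⟨x, h, rfl⟩)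
      | zero => simp
      | add x y _ _ hx hy => rw [map_add]; exact add_mem hx hy
      | smul a x hx' hx =>
        rw [hspan] at hx'
        have : φ (a • x) = a.coeff 0 • φ x := by
          ext e
          simp [φ, lcoeff, coeff_mul_of_mem_lssIdeal hx' (hc e)]
        rw [this]
        exact Submodule.smul_mem _ _ hx
    have htop : Submodule.span k ((s.image φ : Finset _) : Set (G.edgeSet → k)) = ⊤ := by
      rw [eq_top_iff, ← (Pi.basisFun k G.edgeSet).span_eq, Submodule.span_le]
      rintro _ ⟨e, rfl⟩
      have he : edgePoly k d (e : Sym2 V) ∈ lssIdeal k G d := by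
        rw [lssIdeal_eq_span]; exact Ideal.subset_span ⟨e, e.2, rfl⟩
      have h0 := (hc' e e).2 rfl
      have : Pi.basisFun k G.edgeSet e =
          ((edgePoly k d (e : Sym2 V)).coeff (c e))⁻¹ • φ (edgePoly k d (e : Sym2 V)) := by
        ext e'
        simp only [φ, Pi.basisFun_apply, Pi.smul_apply, LinearMap.pi_apply, lcoeff_apply, smul_eq_mul]
        rcases eq_or_ne e' e with rfl | hne
        · rw [Pi.single_eq_same, inv_mul_cancel₀ h0]
        · rw [Pi.single_eq_of_ne hne, not_ne_iff.1 fun h ↦ hne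
            (Subtype.ext ((hc' e' e).1 h).symm), mul_zero]
      rw [this]
      exact Submodule.smul_mem _ _ (hφ _ he)
    have h1 := finrank_span_finset_le_card (R := k) (s.image φ)
    rw [Set.finrank, htop, finrank_top, Module.finrank_fintype_fun_eq_card] at h1
    rw [← Nat.card_coe_set_eq, Nat.card_eq_fintype_card, ← hs]
    exact h1.trans Finset.card_image_le

/-- The height of a Lovász–Saks–Schrijver ideal is at most the number of variables of the vertices
in `Z` plus the number of edges that avoid `Z`. -/
theorem height_lssIdeal_le [Finite V] (G : SimpleGraph V) (Z : Finset V) :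
    (lssIdeal k G d).height ≤
      ((d * Z.card + {e ∈ G.edgeSet | ∀ z ∈ Z, z ∉ e}.ncard : ℕ) : ℕ∞) := by
  classical
  let A : Set (MvPolynomial (V × Fin d) k) :=
    (((Z ×ˢ Finset.univ).image X : Finset (MvPolynomial (V × Fin d) k)) : Set _)
  let B : Set (MvPolynomial (V × Fin d) k) := edgePoly k d '' {e ∈ G.edgeSet | ∀ z ∈ Z, z ∉ e}
  have hA : A.ncard ≤ d * Z.card := by
    rw [Set.ncard_coe_finset]
    refine Finset.card_image_le.trans ?_
    simp [mul_comm]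
  have hB : B.ncard ≤ {e ∈ G.edgeSet | ∀ z ∈ Z, z ∉ e}.ncard :=
    Set.ncard_image_le (Set.toFinite _)
  have hfin : (A ∪ B).Finite := (Finset.finite_toSet _).union ((Set.toFinite _).image _)
  -- Krull's height theorem needs a proper ideal; all these generators vanish at the origin.
  have hne : Ideal.span (A ∪ B) ≠ ⊤ := by
    have hle : Ideal.span (A ∪ B) ≤ RingHom.ker (constantCoeff (R := k) (σ := V × Fin d)) := by
      rw [Ideal.span_le]
      rintro _ (h | ⟨e, -, rfl⟩)
      · obtain ⟨z, -, rfl⟩ := Finset.mem_image.1 (Finset.mem_coe.1 h)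
        simp
      · exact coeff_edgePoly_eq_zero_of_degree_ne_two (by simp)
    intro h
    rw [h, top_le_iff] at hle
    exact RingHom.ker_ne_top _ hle
  have hle : lssIdeal k G d ≤ Ideal.span (A ∪ B) := by
    rw [lssIdeal_eq_span, Ideal.span_le]
    rintro _ ⟨e, he, rfl⟩
    by_cases hz : ∀ z ∈ Z, z ∉ e
    · exact Ideal.subset_span (Or.inr ⟨e, ⟨he, hz⟩, rfl⟩)
    push Not at hz
    obtain ⟨z, hz, hze⟩ := hz
    obtain ⟨w, rfl⟩ := Sym2.mem_iff_exists.1 hze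
    have hX : ∀ l, (X (z, l) : MvPolynomial (V × Fin d) k) ∈ A := fun l ↦
      Finset.mem_coe.2 (Finset.mem_image_of_mem _ (by simpa using hz))
    change lssPoly k d z w ∈ Ideal.span (A ∪ B)
    exact Ideal.sum_mem _ fun l _ ↦ Ideal.mul_mem_right _ _ (Ideal.subset_span (Or.inl (hX l)))
  refine (Ideal.height_mono hle).trans ((Ideal.height_le_spanFinrank _ hne).trans ?_)
  exact_mod_cast (Submodule.spanFinrank_span_le_ncard_of_finite hfin).trans
    ((Set.ncard_union_le A B).trans (add_le_add hA hB))

end NumberOfGenerators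

/-! ### Localization at minimal primes. -/

section LocalCompleteIntersection

variable {R : Type*} [CommRing R]

/-- The contraction of a prime containing the localization of an ideal at a minimal prime is that
minimal prime. -/
theorem Ideal.comap_eq_of_mem_minimalPrimes_of_map_le {I p : Ideal R} [p.IsPrime]
    (hp : p ∈ I.minimalPrimes) {q : Ideal (Localization.AtPrime p)} [q.IsPrime]
    (hq : I.map (algebraMap R (Localization.AtPrime p)) ≤ q) :
    q.comap (algebraMap R (Localization.AtPrime p)) = p := by
  have hle : q.comap (algebraMap R (Localization.AtPrime p)) ≤ p := by
    have h1 := Ideal.comap_mono (f := algebraMap R (Localization.AtPrime p))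
      (IsLocalRing.le_maximalIdeal (Ideal.IsPrime.ne_top ‹q.IsPrime›))
    rwa [← Ideal.under_def _ (IsLocalRing.maximalIdeal _), Localization.AtPrime.under_maximalIdeal]
      at h1
  exact le_antisymm hle (hp.2 ⟨inferInstance, Ideal.map_le_iff_le_comap.1 hq⟩ hle)

theorem Ideal.map_ne_top_of_le_prime {I p : Ideal R} [p.IsPrime] (h : I ≤ p) :
    I.map (algebraMap R (Localization.AtPrime p)) ≠ ⊤ := fun e ↦
  (IsLocalRing.maximalIdeal.isMaximal (Localization.AtPrime p)).ne_top <| top_le_iff.1 <| e ▸ by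
    rw [← Localization.AtPrime.map_eq_maximalIdeal]
    exact Ideal.map_mono h

/-- Every prime over the localized ideal contracts to `p`, and contraction from a localization
preserves height. -/
theorem Ideal.height_le_height_map_of_mem_minimalPrimes {I p : Ideal R} [p.IsPrime]
    (hp : p ∈ I.minimalPrimes) :
    p.height ≤ (I.map (algebraMap R (Localization.AtPrime p))).height := by
  rw [Ideal.height_eq_inf_minimalPrimes (I.map _)]
  refine le_iInf₂ fun q hq ↦ ?_
  have := hq.isPrime
  rw [← IsLocalization.height_under p.primeCompl q, Ideal.under_def,
    Ideal.comap_eq_of_mem_minimalPrimes_of_map_le hp hq.le]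

/-- The localization of a radical ideal at one of its minimal primes contains the extension of that
prime. -/
theorem Ideal.IsRadical.map_le_map_of_mem_minimalPrimes {J p : Ideal R} [p.IsPrime]
    (hJ : J.IsRadical) (hp : p ∈ J.minimalPrimes) :
    p.map (algebraMap R (Localization.AtPrime p)) ≤
      J.map (algebraMap R (Localization.AtPrime p)) := by
  rw [← hJ.radical, IsLocalization.map_radical p.primeCompl, Ideal.radical_eq_sInf]
  refine le_sInf fun q ⟨hq, hq'⟩ ↦ ?_
  rw [Ideal.map_le_iff_le_comap, Ideal.comap_eq_of_mem_minimalPrimes_of_map_le hp hq]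

/-- An ideal with `n + 1` generators that contains a radical ideal of height at least `n` with `n`
generators is a complete intersection at each of its minimal primes. -/
theorem Ideal.isCompleteIntersectionIdeal_map_of_isRadical [IsNoetherianRing R] {I J : Ideal R}
    (hJI : J ≤ I) (hJ : J.IsRadical) {n : ℕ} (hn : n ≤ J.height) (hJn : J.spanFinrank ≤ n)
    (hI : I.spanFinrank ≤ n + 1) {p : Ideal R} [p.IsPrime] (hp : p ∈ I.minimalPrimes) :
    IsCompleteIntersectionIdeal (I.map (algebraMap R (Localization.AtPrime p))) := by
  refine ⟨IsNoetherian.noetherian _, le_antisymm ?_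
    (Ideal.height_le_spanFinrank _ (Ideal.map_ne_top_of_le_prime hp.1.2))⟩
  refine le_trans ?_ (Ideal.height_le_height_map_of_mem_minimalPrimes hp)
  have hJp : J ≤ p := hJI.trans hp.1.2
  -- If `p` has height at least `n + 1`, the generator count suffices. Otherwise `p` is already
  -- minimal over the radical `J`, so `I` and `J` agree locally and `n` generators suffice.
  by_cases h : ((n + 1 : ℕ) : ℕ∞) ≤ p.height
  · refine le_trans ?_ h
    exact_mod_cast (Ideal.spanFinrank_map_le_of_fg _ (IsNoetherian.noetherian I)).trans hI
  · have hpn : p.height ≤ n := by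
      rw [not_le] at h
      push_cast at h
      exact Order.le_of_lt_add_one h
    have hpJ : p ∈ J.minimalPrimes := Ideal.mem_minimalPrimes_of_height_le hJp (hpn.trans hn)
    have heq : I.map (algebraMap R (Localization.AtPrime p)) =
        J.map (algebraMap R (Localization.AtPrime p)) :=
      le_antisymm ((Ideal.map_mono hp.1.2).trans (hJ.map_le_map_of_mem_minimalPrimes hpJ))
        (Ideal.map_mono hJI)
    rw [heq]
    refine le_trans ?_ (hn.trans (Ideal.height_mono hJp))
    exact_mod_cast (Ideal.spanFinrank_map_le_of_fg _ (IsNoetherian.noetherian J)).trans hJn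

end LocalCompleteIntersection

/-! ### Edge counts and the combinatorics of edge joins. -/

section EdgeJoin

namespace SimpleGraph

variable {V : Type*} {G : SimpleGraph V}

theorem degree_eq_ncard_neighborSet (v : V) [Fintype (G.neighborSet v)] :
    G.degree v = (G.neighborSet v).ncard := by
  rw [← card_neighborSet_eq_degree, ← Nat.card_eq_fintype_card, Nat.card_coe_set_eq]

theorem ncard_incidenceSet (v : V) : (G.incidenceSet v).ncard = (G.neighborSet v).ncard := by
  classical
  rw [← Nat.card_coe_set_eq, ← Nat.card_coe_set_eq]
  exact Nat.card_congr (G.incidenceSetEquivNeighborSet v)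

theorem ncard_edgeSet_eq_add [Finite V] (v : V) :
    G.edgeSet.ncard =
      (G.neighborSet v).ncard + {e ∈ G.edgeSet | ∀ z ∈ ({v} : Finset V), z ∉ e}.ncard := by
  classical
  rw [← ncard_incidenceSet, ← Set.ncard_union_eq _ (Set.toFinite _) (Set.toFinite _)]
  · congr 1
    ext e
    simp only [incidenceSet, Finset.mem_singleton, forall_eq, Set.mem_union, Set.mem_ofPred_eq]
    tauto
  · rw [Set.disjoint_left]
    rintro e ⟨-, h⟩ ⟨-, h'⟩
    exact h' v (by simp) h

/-- Non-adjacency makes the two incidence sets disjoint, so no edge is counted twice. -/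
theorem ncard_edgeSet_eq_add_add [Finite V] [DecidableEq V] {u v : V} (huv : u ≠ v) (hadj : ¬ G.Adj u v) :
    G.edgeSet.ncard = (G.neighborSet u).ncard + (G.neighborSet v).ncard +
      {e ∈ G.edgeSet | ∀ z ∈ ({u, v} : Finset V), z ∉ e}.ncard := by
  rw [← ncard_incidenceSet, ← ncard_incidenceSet, ← Set.ncard_union_eq _ (Set.toFinite _)
    (Set.toFinite _), ← Set.ncard_union_eq _ (Set.toFinite _) (Set.toFinite _)]
  · congr 1
    ext e
    simp only [incidenceSet, Finset.mem_insert, Finset.mem_singleton, forall_eq_or_imp, forall_eq,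
      Set.mem_union, Set.mem_ofPred_eq]
    tauto
  · rw [Set.disjoint_left]
    rintro e (⟨-, h⟩ | ⟨-, h⟩) ⟨-, h'⟩
    · exact h' u (by simp) h
    · exact h' v (by simp) h
  · rw [Set.disjoint_iff_inter_eq_empty]
    exact G.incidenceSet_inter_incidenceSet_of_not_adj hadj huv

/-- A connected component of a spanning subgraph `F` of `G`, as a subgraph of `G`. -/
def componentSubgraph {F : SimpleGraph V} (h : F ≤ G) (c : F.ConnectedComponent) : G.Subgraph where
  verts := c.supp
  Adj a b := F.Adj a b ∧ a ∈ c.supp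
  adj_sub h' := h h'.1
  edge_vert h' := h'.2
  symm := ⟨fun _ _ h' ↦ ⟨h'.1.symm, (c.mem_supp_congr_adj h'.1).1 h'.2⟩⟩

theorem coe_componentSubgraph {F : SimpleGraph V} (h : F ≤ G) (c : F.ConnectedComponent) :
    (componentSubgraph h c).coe = c.toSimpleGraph := by
  ext a b
  exact and_iff_left a.2

/-- A tree in which every vertex has degree at most `d` after removal of one edge is obtained by
joining two trees of maximal degree at most `d` by an edge. -/
theorem IsTree.isEdgeJoinOfTrees {V : Type*} [Fintype V] {G : SimpleGraph V} (hG : G.IsTree)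
    {d : ℕ} {u v : V} (huv : G.Adj u v)
    (hdeg : ∀ x, ((G.deleteEdges {s(u, v)}).neighborSet x).ncard ≤ d) :
    IsEdgeJoinOfTrees G d := by
  classical
  set F := G.deleteEdges {s(u, v)} with hF
  have hle : F ≤ G := G.deleteEdges_le _
  have hFa : F.IsAcyclic := hG.isAcyclic.anti hle
  have hGF : G = F ⊔ edge u v := by
    ext a b
    simp only [hF, sup_adj, deleteEdges_adj, edge_adj, Set.mem_singleton_iff, Sym2.eq_iff]
    constructor
    · intro h
      have := h.ne
      tauto
    · rintro (h | ⟨⟨rfl, rfl⟩ | ⟨rfl, rfl⟩, -⟩)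
      exacts [h.1, huv, huv.symm]
  have hnr : ¬ F.Reachable u v := isAcyclic_iff_forall_adj_isBridge.1 hG.isAcyclic huv
  have hcov : ∀ x, F.Reachable u x ∨ F.Reachable v x := by
    intro x
    obtain ⟨p⟩ := hG.connected u x
    have key : ∀ {a b : V} (p : G.Walk a b), (F.Reachable u a ∨ F.Reachable v a) →
        (F.Reachable u b ∨ F.Reachable v b) := by
      intro a b p
      induction p with
      | nil => exact id
      | cons h p ih =>
        intro ha
        apply ih
        rw [hGF, sup_adj, edge_adj] at h
        rcases h with h | ⟨⟨rfl, rfl⟩ | ⟨rfl, rfl⟩, -⟩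
        · exact ha.imp (·.trans h.reachable) (·.trans h.reachable)
        · exact Or.inr .rfl
        · exact Or.inl .rfl
    exact key p (Or.inl .rfl)
  have hmem : ∀ x y, y ∈ (F.connectedComponentMk x).supp ↔ F.Reachable x y := fun x y ↦ by
    rw [ConnectedComponent.mem_supp_iff, ConnectedComponent.eq]
    exact reachable_comm
  have htree : ∀ c : F.ConnectedComponent, (componentSubgraph hle c).coe.IsTree := fun c ↦ by
    rw [coe_componentSubgraph]
    exact hFa.isTree_connectedComponent c
  have hmax : ∀ c : F.ConnectedComponent, (componentSubgraph hle c).coe.maxDegree ≤ d := by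
    intro c
    refine maxDegree_le_of_forall_degree_le _ _ fun x ↦ ?_
    rw [degree_eq_ncard_neighborSet, ← Set.ncard_image_of_injective _ Subtype.val_injective]
    refine (Set.ncard_le_ncard ?_ (Set.toFinite _)).trans (hdeg x)
    rintro _ ⟨y, hy, rfl⟩
    exact hy.1
  refine ⟨componentSubgraph hle (F.connectedComponentMk u),
    componentSubgraph hle (F.connectedComponentMk v), htree _, htree _, ?_, ?_, hmax _, hmax _,
    u, (hmem u u).2 .rfl, v, (hmem v v).2 .rfl, ?_⟩
  · rw [Set.disjoint_left]
    intro x hx hx'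
    exact hnr (((hmem u x).1 hx).trans ((hmem v x).1 hx').symm)
  · ext x
    simpa [componentSubgraph, hmem, -ConnectedComponent.mem_supp_iff] using hcov x
  · conv_lhs => rw [hGF]
    congr 1
    ext a b
    simp only [sup_adj, Subgraph.spanningCoe_adj, componentSubgraph, hmem]
    have := hcov a
    tauto

theorem ncard_neighborSet_spanningCoe_le [Fintype V] {H : G.Subgraph} [Fintype H.verts]
    [DecidableRel H.coe.Adj] {v : V} (hv : v ∈ H.verts) :
    (H.spanningCoe.neighborSet v).ncard ≤ H.coe.maxDegree := by
  refine le_trans ?_ (H.coe.degree_le_maxDegree ⟨v, hv⟩)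
  rw [degree_eq_ncard_neighborSet, ← Set.ncard_image_of_injective _ Subtype.val_injective]
  refine Set.ncard_le_ncard (fun w hw ↦ ?_) (Set.toFinite _)
  exact ⟨⟨w, H.edge_vert (H.adj_symm hw)⟩, hw, rfl⟩

/-- A graph obtained by joining two trees by an edge has a spanning subgraph with exactly one edge
less whose degrees are bounded by those of the trees. -/
theorem exists_le_of_isEdgeJoinOfTrees {V : Type*} [Fintype V] {G : SimpleGraph V} {d : ℕ}
    (h : IsEdgeJoinOfTrees G d) :
    ∃ F ≤ G, G.edgeSet.ncard = F.edgeSet.ncard + 1 ∧ ∀ v, (F.neighborSet v).ncard ≤ d := by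
  classical
  obtain ⟨H₁, H₂, -, -, hdisj, hunion, h₁, h₂, u, hu, v, hv, hG⟩ := h
  rw [Set.disjoint_left] at hdisj
  refine ⟨H₁.spanningCoe ⊔ H₂.spanningCoe, le_sup_left.trans hG.ge, ?_, fun x ↦ ?_⟩
  · have huv : u ≠ v := by rintro rfl; exact hdisj hu hv
    conv_lhs => rw [hG]
    rw [edgeSet_sup _ (edge u v), edgeSet_edge_of_ne huv, Set.union_singleton,
      Set.ncard_insert_of_notMem _ (Set.toFinite _)]
    rintro (h | h)
    · exact hdisj (H₁.edge_vert (H₁.adj_symm h)) hv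
    · exact hdisj hu (H₂.edge_vert h)
  · have hx : x ∈ H₁.verts ∪ H₂.verts := hunion ▸ Set.mem_univ x
    rcases hx with hx | hx
    · refine le_trans (Set.ncard_le_ncard ?_ (Set.toFinite _))
        ((ncard_neighborSet_spanningCoe_le hx).trans h₁)
      rintro w (hw | hw)
      · exact hw
      · exact absurd (H₂.edge_vert hw) (hdisj hx)
    · refine le_trans (Set.ncard_le_ncard ?_ (Set.toFinite _))
        ((ncard_neighborSet_spanningCoe_le hx).trans h₂)
      rintro w (hw | hw)
      · exact absurd hx (hdisj (H₁.edge_vert hw))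
      · exact hw

end SimpleGraph

end EdgeJoin

/-! ### The two implications and the theorem. -/

open SimpleGraph in
/-- The Lovász–Saks–Schrijver ideal of an edge join of two trees of maximal degree at most `d` is an
almost complete intersection, unless all degrees are at most `d`. -/
theorem IsEdgeJoinOfTrees.isAlmostCompleteIntersectionIdeal {k V : Type*} [Field k] [Fintype V]
    {d : ℕ} (hd : 0 < d) {G : SimpleGraph V} (hG : G.IsAcyclic) (h : IsEdgeJoinOfTrees G d) {v : V}
    (hv : d < (G.neighborSet v).ncard) :
    IsAlmostCompleteIntersectionIdeal (lssIdeal k G d) := by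
  obtain ⟨F, hFG, hcard, hdeg⟩ := exists_le_of_isEdgeJoinOfTrees h
  have hF := hG.anti hFG
  have hle : lssIdeal k F d ≤ lssIdeal k G d := by
    rw [lssIdeal_eq_span, lssIdeal_eq_span]
    exact Ideal.span_mono (Set.image_mono (edgeSet_mono hFG))
  have hht := hF.ncard_edgeSet_le_height_lssIdeal (k := k) hd hdeg
  refine ⟨IsNoetherian.noetherian _, ?_, fun p _ hp ↦
    Ideal.isCompleteIntersectionIdeal_map_of_isRadical hle (hF.isRadical_lssIdeal hd hdeg) hht
      (spanFinrank_lssIdeal hd F).le (by rw [spanFinrank_lssIdeal hd, hcard]) hp⟩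
  -- Taking `Z = {v}` trades more than `d` edges for `d` variables, so the height drops below the
  -- number of edges.
  have h1 : (lssIdeal k G d).height = (F.edgeSet.ncard : ℕ∞) := by
    refine le_antisymm ((height_lssIdeal_le G {v}).trans ?_) (hht.trans (Ideal.height_mono hle))
    have h2 := ncard_edgeSet_eq_add (G := G) v
    rw [Finset.card_singleton]
    exact_mod_cast (by omega)
  rw [spanFinrank_lssIdeal hd, hcard, h1]
  push_cast
  rfl

open SimpleGraph in
/-- If the Lovász–Saks–Schrijver ideal of a tree has height one less than the number of edges, then
the tree is an edge join of two trees of maximal degree at most `d`. -/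
theorem isEdgeJoinOfTrees_of_ncard_edgeSet_eq {k V : Type*} [Field k] [Fintype V] {d : ℕ}
    {G : SimpleGraph V} (hG : G.IsTree)
    (h : (G.edgeSet.ncard : ℕ∞) = (lssIdeal k G d).height + 1) {w : V}
    (hw : d < (G.neighborSet w).ncard) : IsEdgeJoinOfTrees G d := by
  classical
  have hZ : ∀ Z : Finset V,
      G.edgeSet.ncard ≤ d * Z.card + {e ∈ G.edgeSet | ∀ z ∈ Z, z ∉ e}.ncard + 1 := fun Z ↦ by
    have h1 := h.le.trans (add_le_add_left (height_lssIdeal_le G Z) 1)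
    exact_mod_cast h1
  have hdeg : ∀ x, (G.neighborSet x).ncard ≤ d + 1 := fun x ↦ by
    have h1 := hZ {x}
    have h2 := ncard_edgeSet_eq_add (G := G) x
    rw [Finset.card_singleton] at h1
    omega
  -- For non-adjacent `x` and `y`, taking `Z = {x, y}` would trade at least `2 * d + 2` edges for `2
  -- * d` variables, losing two.
  have hadj : ∀ x y, x ≠ y → d < (G.neighborSet x).ncard → d < (G.neighborSet y).ncard →
      G.Adj x y := by
    intro x y hxy hx hy
    by_contra hn
    have h1 := hZ {x, y}
    have h2 := ncard_edgeSet_eq_add_add hxy hn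
    rw [Finset.card_pair hxy] at h1
    omega
  -- `w'` is the other vertex of degree above `d`, or an arbitrary neighbour of `w` if there is
  -- none; a third such vertex would close a triangle.
  obtain ⟨w', hww', hw'⟩ : ∃ w', G.Adj w w' ∧
      ∀ x, x ≠ w → d < (G.neighborSet x).ncard → x = w' := by
    by_cases hex : ∃ w', w' ≠ w ∧ d < (G.neighborSet w').ncard
    · obtain ⟨w', hne, hw'⟩ := hex
      refine ⟨w', hadj w w' hne.symm hw hw', fun x hxw hx ↦ ?_⟩
      by_contra hxw'
      exact hG.isAcyclic.cliqueFree le_rfl {w, w', x} (is3Clique_triple_iff.2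
        ⟨hadj _ _ hne.symm hw hw', hadj _ _ (Ne.symm hxw) hw hx,
          hadj _ _ (Ne.symm hxw') hw' hx⟩)
    · push Not at hex
      obtain ⟨w', hw'⟩ := (Set.ncard_pos (Set.toFinite _)).1 (Nat.zero_lt_of_lt hw)
      exact ⟨w', hw', fun x hxw hx ↦ absurd (hex x hxw) hx.not_ge⟩
  refine hG.isEdgeJoinOfTrees hww' fun x ↦ ?_
  have hsub : (G.deleteEdges {s(w, w')}).neighborSet x ⊆ G.neighborSet x :=
    fun y hy ↦ (deleteEdges_le (G := G) _) hy
  have hend : ∀ y, G.Adj x y → s(x, y) = s(w, w') →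
      ((G.deleteEdges {s(w, w')}).neighborSet x).ncard ≤ d := by
    intro y hxy he
    have := Set.ncard_lt_ncard (hsub.ssubset_of_mem_notMem (a := y) hxy fun h' ↦
      (deleteEdges_adj.1 h').2 he) (Set.toFinite _)
    have := hdeg x
    omega
  rcases eq_or_ne x w with rfl | hxw
  · exact hend w' hww' rfl
  rcases eq_or_ne x w' with rfl | hxw'
  · exact hend w hww'.symm Sym2.eq_swap
  · exact (Set.ncard_le_ncard hsub (Set.toFinite _)).trans
      (not_lt.1 fun hlt ↦ hxw' (hw' x hxw hlt))

theorem mainTheorem3 (k : Type*) [Field k] (n d : ℕ) (hd : 0 < d)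
    (G : SimpleGraph (Fin n)) [DecidableRel G.Adj] (hG : G.IsTree) (hdeg : d < G.maxDegree) :
    IsAlmostCompleteIntersectionIdeal (lssIdeal k G d) ↔ IsEdgeJoinOfTrees G d := by
  have := hG.connected.nonempty
  obtain ⟨v, hv⟩ := G.exists_maximal_degree_vertex
  rw [hv, SimpleGraph.degree_eq_ncard_neighborSet] at hdeg
  refine ⟨fun h ↦ ?_, fun h ↦ h.isAlmostCompleteIntersectionIdeal hd hG.isAcyclic hdeg⟩
  exact isEdgeJoinOfTrees_of_ncard_edgeSet_eq hG
    (by rw [← h.2.1, spanFinrank_lssIdeal hd]) hdeg
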